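/- Conventions: $\log 0=-\infty$; $\|\cdot\|$ denotes the operator norm on square complex matrices induced by the Euclidean norm; integrals of functions with values in $\mathbb{R}\cup\{-\infty\}$ that are bounded above take values in $\mathbb{R}\cup\{-\infty\}$. Let $\mathcal{I}$ be a compact metric space, let $i\mapsto A_i$ be a continuous map from $\mathcal{I}$ to the $d\times d$ complex matrices, and write $\mathsf{A}=\{A_i : i\in\mathcal{I}\}$. Let $\Sigma_{\mathcal{I}}=\mathcal{I}^{\mathbb{N}}$ be the space of sequences $x=(x_i)_{i=1}^\infty$ in $\mathcal{I}$, with the product topology, and let $\sigma\colon\Sigma_{\mathcal{I}}\to\Sigma_{\mathcal{I}}$, $\sigma[(x_i)_{i=1}^\infty]=(x_{i+1})_{i=1}^\infty$, be the shift. For any family $\mathsf{C}=(C_i)_{i\in\mathcal{I}}$ of square complex matrices of a common size, and for $x\in\Sigma_{\mathcal{I}}$ and $n\ge1$, put \[\mathcal{L}_{\mathsf{C}}(x,n)=C_{x_n}C_{x_{n-1}}\cdots C_{x_1}.\] Let $0<k<d$, and suppose that $\left(\mathsf{A}^{(1)},\mathsf{A}^{(2)},\mathsf{B},M\right)$ is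 an upper triangularisation of $\mathsf{A}$: that is, $M$ is an invertible $d\times d$ complex matrix, and $\mathsf{A}^{(1)}=(A_i^{(1)})_{i\in\mathcal{I}}$, $\mathsf{A}^{(2)}=(A_i^{(2)})_{i\in\mathcal{I}}$ and $\mathsf{B}=(B_i)_{i\in\mathcal{I}}$ are families of complex matrices of sizes $k\times k$, $(d-k)\times(d-k)$ and $k\times(d-k)$ respectively, such that for every $i\in\mathcal{I}$ \[M^{-1}A_iM=\begin{pmatrix}A_i^{(1)}&B_i\\0&A_i^{(2)}\end{pmatrix}.\] Then for every ergodic $\sigma$-invariant Borel probability measure $\mu$ on $\Sigma_{\mathcal{I}}$, \[\inf_{n\ge1}\frac1n\int\log\|\mathcal{L}_{\mathsf{A}}(x,n)\|\,d\mu(x)=\max_{j=1,2}\ \inf_{n\ge1}\frac1n\int\log\|\mathcal{L}_{\mathsf{A}^{(j)}}(x,n)\|\,d\mu(x),\] as an equality in $\mathbb{R}\cup\{-\infty\}$. -/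

import Mathlib

open MeasureTheory

noncomputable section

namespace MatrixCocycle

/-- The one-sided shift `(x₀, x₁, x₂, …) ↦ (x₁, x₂, …)` on the sequence space over `I`. -/
def shift {I : Type*} (x : ℕ → I) : ℕ → I := fun n => x (n + 1)

/-- The partial product `A_{x_{n-1}} ⋯ A_{x_1} A_{x_0}` of `n` factors along a sequence of indices.
Sequences are indexed from `0` here, so the most recent factor stands on the left. -/
def product {I : Type*} {d : ℕ} (A : I → Matrix (Fin d) (Fin d) ℂ) (x : ℕ → I) :
    ℕ → Matrix (Fin d) (Fin d) ℂ
  | 0 => 1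
  | n + 1 => A (x n) * product A x n

/-- The logarithm of the operator norm of a square complex matrix induced by the Euclidean norm
on `ℂ^d`, with the convention `log 0 = -∞`. -/
def logNorm {d : ℕ} (L : Matrix (Fin d) (Fin d) ℂ) : EReal :=
  ENNReal.log ‖Matrix.toEuclideanCLM (n := Fin d) (𝕜 := ℂ) L‖ₑ

/-- The Lebesgue integral of an extended-real-valued function, the integral of the positive part
minus the integral of the negative part. It is used only for functions that are bounded above with
respect to probability measures; there the first term is finite and the value lies in
`ℝ ∪ {-∞}`. -/
def extIntegral {X : Type*} [MeasurableSpace X] (μ : Measure X) (f : X → EReal) : EReal :=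
  ((∫⁻ x, (f x).toENNReal ∂μ : ENNReal) : EReal) - ((∫⁻ x, (-f x).toENNReal ∂μ : ENNReal) : EReal)

/-- The top Lyapunov exponent `inf_{n ≥ 1} (1/n) ∫ log ‖A_{x_{n-1}} ⋯ A_{x_0}‖ dμ(x)`. -/
def lyapunovExponent {I : Type*} [MeasurableSpace I] {d : ℕ}
    (A : I → Matrix (Fin d) (Fin d) ℂ) (μ : Measure (ℕ → I)) : EReal :=
  ⨅ (n : ℕ) (_ : 1 ≤ n), extIntegral μ (fun x => logNorm (product A x n)) / (n : EReal)

/-- The order-preserving splitting of `d` coordinates into the first `k` and the last `d - k`. -/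
def blockEquiv {k d : ℕ} (h : k ≤ d) : Fin k ⊕ Fin (d - k) ≃ Fin d :=
  finSumFinEquiv.trans (finCongr (Nat.add_sub_of_le h))

/-- `(A₁, A₂, B, M)` is an upper triangularisation of the indexed family `A` of `d × d` matrices,
with diagonal blocks of sizes `k` and `d - k`, where `0 < k < d`. -/
structure IsUpperTriangularisation {I : Type*} {d k : ℕ} (A : I → Matrix (Fin d) (Fin d) ℂ)
    (A₁ : I → Matrix (Fin k) (Fin k) ℂ) (A₂ : I → Matrix (Fin (d - k)) (Fin (d - k)) ℂ)
    (B : I → Matrix (Fin k) (Fin (d - k)) ℂ) (M : Matrix (Fin d) (Fin d) ℂ) : Prop where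
  pos : 0 < k
  lt : k < d
  isUnit : IsUnit M
  conj : ∀ i, M⁻¹ * A i * M =
    Matrix.reindex (blockEquiv lt.le) (blockEquiv lt.le) (Matrix.fromBlocks (A₁ i) (B i) 0 (A₂ i))

end MatrixCocycle

end

/-! The exponent is unchanged when the products are transformed by a fixed linear bijection, because
a constant factor is lost in the limit (`lyapunovExponent_lt_of_linearMap`). The diagonal blocks of
a product are linear images of it, so neither diagonal exponent exceeds the full one.

For the converse, let both diagonal exponents lie below `c' < c`. By the mean ergodic theorem there
are arbitrarily large `n` at which the log-norms of both diagonal products, floored at `E = exp (n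
c')`, have integral at most `n (c' + ε)` (`exists_eventually_integral_log_max_le`). For `a, b ≥ E`
one has `max a b ≤ a b / E`, so the floored maximum has log-integral at most `n (c' + 2 ε)`. The
off-diagonal product at this one time is bounded by compactness. Scaling `B` by a small `t ≠ 0`
brings it below `E`; this is a block diagonal conjugation, so the exponent is unaffected. One time
`n` is enough because the exponent is an infimum. The floors also keep every integral finite where
the logarithm is `-∞`. -/

section

/-! ### The mean ergodic theorem in L¹. -/

open Filter Topology

/-- **Mean ergodic theorem** in `L¹`, for square-integrable observables. -/
theorem Ergodic.tendsto_integral_abs_birkhoffAverage_sub {X : Type*} [MeasurableSpace X]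
    {μ : Measure X} [IsProbabilityMeasure μ] {T : X → X} (hT : Ergodic T μ) {g : X → ℝ}
    (hg : MemLp g 2 μ) :
    Tendsto (fun n : ℕ => ∫ x, |birkhoffAverage ℝ T g n x - ∫ y, g y ∂μ| ∂μ) atTop (𝓝 0) := by
  have hmp := hT.toMeasurePreserving
  let U : Lp ℝ 2 μ →L[ℝ] Lp ℝ 2 μ :=
    (Lp.compMeasurePreservingₗᵢ ℝ T hmp).toContinuousLinearMap
  have hU : ∀ f, U f = Lp.compMeasurePreserving T hmp f := fun f => rfl
  have hiter : ∀ n, U^[n] (hg.toLp g) =ᵐ[μ] g ∘ T^[n] := by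
    intro n
    have : U^[n] (hg.toLp g) = Lp.compMeasurePreserving T^[n] (hmp.iterate n) (hg.toLp g) := by
      rw [← Lp.compMeasurePreserving_iterate]
      rfl
    rw [this]
    refine (Lp.coeFn_compMeasurePreserving _ _).trans ?_
    exact (hmp.iterate n).quasiMeasurePreserving.ae_eq_comp hg.coeFn_toLp
  have havg : ∀ n, ((birkhoffAverage ℝ U _root_.id n (hg.toLp g) : Lp ℝ 2 μ) : X → ℝ)
      =ᵐ[μ] birkhoffAverage ℝ T g n := by
    intro n
    have hsum : ∀ n, ((birkhoffSum U _root_.id n (hg.toLp g) : Lp ℝ 2 μ) : X → ℝ)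
        =ᵐ[μ] birkhoffSum T g n := by
      intro n
      induction n with
      | zero => simpa using Lp.coeFn_zero ℝ 2 μ
      | succ n ih =>
        rw [birkhoffSum_succ]
        filter_upwards [Lp.coeFn_add (birkhoffSum U _root_.id n (hg.toLp g))
          (_root_.id (U^[n] (hg.toLp g))), ih, hiter n] with x h1 h2 h3
        rw [h1, Pi.add_apply, h2, birkhoffSum_succ]
        simp only [_root_.id]
        rw [h3]; rfl
    filter_upwards [Lp.coeFn_smul ((n : ℝ)⁻¹) (birkhoffSum U _root_.id n (hg.toLp g)), hsum n]
      with x h1 h2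
    rw [birkhoffAverage, h1, Pi.smul_apply, h2, birkhoffAverage]
  -- Von Neumann: averages of the Koopman isometry converge in L² to the projection onto its fixed
  -- vectors; ergodicity makes that limit a constant `c`.
  have hlim := U.tendsto_birkhoffAverage_orthogonalProjection
    (LinearIsometry.norm_toContinuousLinearMap_le _) (hg.toLp g)
  set H := (U.eqLocus (1 : Lp ℝ 2 μ →L[ℝ] Lp ℝ 2 μ)).orthogonalProjectionOnto (hg.toLp g) with hH
  obtain ⟨c, hc⟩ : ∃ c, ((H : Lp ℝ 2 μ) : X → ℝ) =ᵐ[μ] Function.const X c := by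
    refine hT.ae_eq_const_of_ae_eq_comp_ae (Lp.aestronglyMeasurable _) ?_
    have h2 : U (H : Lp ℝ 2 μ) = H := H.2
    refine (Lp.coeFn_compMeasurePreserving _ hmp).symm.trans ?_
    rw [← hU, h2]
  have hmem : ∀ n, MemLp (birkhoffAverage ℝ T g n) 2 μ := fun n =>
    (memLp_congr_ae (havg n)).1 (Lp.memLp _)
  have hint : ∀ n c, Integrable (fun x => birkhoffAverage ℝ T g n x - c) μ := fun n c =>
    (((hmem n).integrable (by norm_num))).sub (integrable_const c)
  have hmain : Tendsto (fun n : ℕ => ∫ x, |birkhoffAverage ℝ T g n x - c| ∂μ) atTop (𝓝 0) := by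
    have h0 : Tendsto (fun n => ‖birkhoffAverage ℝ U _root_.id n (hg.toLp g) - H‖) atTop (𝓝 0) :=
      tendsto_iff_norm_sub_tendsto_zero.1 hlim
    refine squeeze_zero (fun n => integral_nonneg fun x => abs_nonneg _) (fun n => ?_) h0
    have hae : (birkhoffAverage ℝ U _root_.id n (hg.toLp g) - H : Lp ℝ 2 μ) =ᵐ[μ]
        fun x => birkhoffAverage ℝ T g n x - c := by
      filter_upwards [Lp.coeFn_sub (birkhoffAverage ℝ U _root_.id n (hg.toLp g)) (H : Lp ℝ 2 μ),
        havg n, hc] with x h1 h2 h3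
      rw [h1, Pi.sub_apply, h2, h3]; rfl
    have hm2 : MemLp (fun x => birkhoffAverage ℝ T g n x - c) 2 μ := (hmem n).sub (memLp_const c)
    rw [Lp.norm_def, eLpNorm_congr_ae hae]
    have h1 : ∫ x, |birkhoffAverage ℝ T g n x - c| ∂μ =
        (eLpNorm (fun x => birkhoffAverage ℝ T g n x - c) 1 μ).toReal := by
      rw [eLpNorm_one_eq_lintegral_enorm, ← integral_norm_eq_lintegral_enorm
        (hint n c).aestronglyMeasurable]
      rfl
    rw [h1]
    exact ENNReal.toReal_mono hm2.eLpNorm_ne_top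
      (eLpNorm_le_eLpNorm_of_exponent_le (by norm_num) hm2.aestronglyMeasurable)
  have hgint : Integrable g μ := hg.integrable (by norm_num)
  have hI : ∀ n : ℕ, n ≠ 0 → ∫ x, birkhoffAverage ℝ T g n x ∂μ = ∫ y, g y ∂μ := by
    intro n hn
    have hk : ∀ k, ∫ x, g (T^[k] x) ∂μ = ∫ y, g y ∂μ := fun k => by
      have h := (hmp.iterate k)
      conv_rhs => rw [← h.map_eq]
      rw [integral_map h.measurable.aemeasurable]
      rw [h.map_eq]; exact hgint.aestronglyMeasurable
    have hik : ∀ k, Integrable (fun x => g (T^[k] x)) μ := fun k =>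
      (hmp.iterate k).integrable_comp_of_integrable hgint
    simp only [birkhoffAverage, birkhoffSum, smul_eq_mul]
    rw [integral_const_mul, integral_finsetSum _ fun k _ => hik k]
    simp only [hk, Finset.sum_const, Finset.card_range, nsmul_eq_mul]
    field_simp
  -- Averaging preserves the integral, and `|∫ g - c|` is at most the L¹ distance to `c`, which
  -- tends to zero.
  have hcc : ∫ y, g y ∂μ = c := by
    have : Tendsto (fun _ : ℕ => |∫ y, g y ∂μ - c|) atTop (𝓝 0) := by
      refine squeeze_zero' (Eventually.of_forall fun n => abs_nonneg _) ?_ hmain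
      filter_upwards [eventually_ne_atTop 0] with n hn
      have : ∫ y, g y ∂μ - c = ∫ x, (birkhoffAverage ℝ T g n x - c) ∂μ := by
        rw [integral_sub ((hmem n).integrable (by norm_num)) (integrable_const c), hI n hn]
        simp
      rw [this]
      exact abs_integral_le_integral_abs
    have := tendsto_nhds_unique this tendsto_const_nhds
    linarith [abs_eq_zero.1 this.symm]
  rwa [hcc]

end

/-! ### Truncated logarithms and the extended integral. -/

namespace MatrixCocycle

open Filter Topology
open scoped Matrix.Norms.L2Operator

theorem integrable_log_max {X : Type*} [MeasurableSpace X] {μ : Measure X} [IsFiniteMeasure μ]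
    {a : X → ℝ} (ha : Measurable a) {R : ℝ} (hR : ∀ x, a x ≤ R) {δ : ℝ} (hδ : 0 < δ) :
    Integrable (fun x => Real.log (max (a x) δ)) μ := by
  refine Integrable.of_bound (C := max |Real.log δ| |Real.log (max R δ)|)
    (ha.max measurable_const).log.aestronglyMeasurable (Eventually.of_forall fun x => ?_)
  rw [Real.norm_eq_abs]
  exact abs_le_max_abs_abs (Real.log_le_log hδ (le_max_right _ _))
    (Real.log_le_log (by positivity) (max_le_max_right _ (hR x)))

theorem toENNReal_log_ofReal (a : ℝ) :
    (ENNReal.log (ENNReal.ofReal a)).toENNReal = ENNReal.ofReal (Real.log (max a 1)) := by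
  rcases le_total a 1 with h | h
  · rw [max_eq_right h, Real.log_one, ENNReal.ofReal_zero]
    apply EReal.toENNReal_of_nonpos
    rw [ENNReal.log_le_zero_iff]
    simpa using h
  · rw [max_eq_left h, ENNReal.log_ofReal_of_pos (by linarith), EReal.real_coe_toENNReal]

theorem ofReal_neg_log_max_le (a δ : ℝ) :
    ENNReal.ofReal (-Real.log (max (min a 1) δ)) ≤
      (-ENNReal.log (ENNReal.ofReal a)).toENNReal := by
  rcases le_or_gt a 0 with h | h
  · simp [ENNReal.ofReal_of_nonpos h]
  · rw [ENNReal.log_ofReal_of_pos h, ← EReal.coe_neg, EReal.real_coe_toENNReal]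
    rcases le_total a 1 with h1 | h1
    · rw [min_eq_left h1]
      exact ENNReal.ofReal_le_ofReal (neg_le_neg (Real.log_le_log h (le_max_left _ _)))
    · rw [min_eq_right h1, ENNReal.ofReal_of_nonpos]
      · exact zero_le
      · simpa using Real.log_nonneg (le_max_left 1 δ)

theorem tendsto_ofReal_neg_log_max {a : ℝ} (ha : 0 ≤ a) :
    Tendsto (fun n : ℕ => ENNReal.ofReal (-Real.log (max (min a 1) (Real.exp (-n))))) atTop
      (𝓝 (-ENNReal.log (ENNReal.ofReal a)).toENNReal) := by
  rcases ha.eq_or_lt with h | h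
  · subst h
    have : ∀ n : ℕ, max (min (0 : ℝ) 1) (Real.exp (-n)) = Real.exp (-n) := fun n => by
      rw [min_eq_left zero_le_one, max_eq_right (Real.exp_pos _).le]
    simp only [this, Real.log_exp, neg_neg, ENNReal.ofReal_natCast]
    simpa using ENNReal.tendsto_nat_nhds_top
  · have h1 : 0 < min a 1 := lt_min h one_pos
    have h2 : Tendsto (fun n : ℕ => Real.exp (-(n : ℝ))) atTop (𝓝 0) :=
      Real.tendsto_exp_neg_atTop_nhds_zero.comp tendsto_natCast_atTop_atTop
    refine tendsto_const_nhds.congr' ?_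
    filter_upwards [h2.eventually (gt_mem_nhds h1)] with n hn
    rw [max_eq_left hn.le, ENNReal.log_ofReal_of_pos h, ← EReal.coe_neg, EReal.real_coe_toENNReal]
    rcases le_total a 1 with h3 | h3
    · rw [min_eq_left h3]
    · rw [min_eq_right h3, Real.log_one, neg_zero, ENNReal.ofReal_zero, ENNReal.ofReal_of_nonpos]
      simpa using Real.log_nonneg h3

/-- The two summands are the positive part of `log a` and its negative part cut off at `log δ`. -/
theorem log_max_eq_add {δ : ℝ} (a : ℝ) (hδ1 : δ ≤ 1) :
    Real.log (max a δ) = Real.log (max a 1) + Real.log (max (min a 1) δ) := by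
  rcases le_total a 1 with h | h
  · simp [h]
  · simp [h, hδ1, hδ1.trans h]

/-- The extended integral of `log a` is determined by the integrals of its truncations. -/
theorem extIntegral_log_lt_iff {X : Type*} [MeasurableSpace X] {μ : Measure X}
    [IsProbabilityMeasure μ] {a : X → ℝ} (ha : Measurable a) (h0 : ∀ x, 0 ≤ a x) {R : ℝ}
    (hR : ∀ x, a x ≤ R) (c : ℝ) :
    extIntegral μ (fun x => ENNReal.log (ENNReal.ofReal (a x))) < c ↔
      ∃ δ > 0, ∫ x, Real.log (max (a x) δ) ∂μ < c := by
  set P := ∫ x, Real.log (max (a x) 1) ∂μ with hP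
  set Q := ∫⁻ x, (-ENNReal.log (ENNReal.ofReal (a x))).toENNReal ∂μ with hQ
  have hP0 : 0 ≤ P := integral_nonneg fun x => Real.log_nonneg (le_max_right _ _)
  have hPi : Integrable (fun x => Real.log (max (a x) 1)) μ := integrable_log_max ha hR one_pos
  have hext : extIntegral μ (fun x => ENNReal.log (ENNReal.ofReal (a x))) = (P : EReal) - Q := by
    rw [extIntegral]
    congr 1
    simp_rw [toENNReal_log_ofReal]
    rw [← ofReal_integral_eq_lintegral_ofReal hPi
      (Eventually.of_forall fun x => Real.log_nonneg (le_max_right _ _)), ← hP,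
      EReal.coe_ennreal_ofReal, max_eq_left hP0]
  have ham : Measurable fun x => min (a x) 1 := ha.min measurable_const
  have hi : ∀ δ : ℝ, 0 < δ → Integrable (fun x => Real.log (max (min (a x) 1) δ)) μ :=
    fun δ hδ => integrable_log_max ham (fun x => min_le_right _ _) hδ
  have hsplit : ∀ δ : ℝ, 0 < δ → δ ≤ 1 → ∫ x, Real.log (max (a x) δ) ∂μ =
      P - ∫ x, -Real.log (max (min (a x) 1) δ) ∂μ := by
    intro δ hδ hδ1
    rw [integral_neg, sub_neg_eq_add, hP, ← integral_add hPi (hi δ hδ)]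
    exact integral_congr_ae (Eventually.of_forall fun x => log_max_eq_add (a x) hδ1)
  have hnn : ∀ δ : ℝ, 0 < δ → δ ≤ 1 → ∀ x, 0 ≤ -Real.log (max (min (a x) 1) δ) := by
    intro δ hδ hδ1 x
    rw [Left.nonneg_neg_iff]
    exact Real.log_nonpos (by positivity) (max_le (min_le_right _ _) hδ1)
  have hof : ∀ δ : ℝ, 0 < δ → δ ≤ 1 →
      ENNReal.ofReal (∫ x, -Real.log (max (min (a x) 1) δ) ∂μ) =
      ∫⁻ x, ENNReal.ofReal (-Real.log (max (min (a x) 1) δ)) ∂μ := fun δ hδ hδ1 =>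
    ofReal_integral_eq_lintegral_ofReal (hi δ hδ).neg (Eventually.of_forall (hnn δ hδ hδ1))
  rw [hext]
  constructor
  · intro h
    -- If no truncation falls below `c`, the truncated negative parts have integrals at most `P -
    -- c`; monotone convergence passes this bound to `Q`.
    by_contra! hcon
    have hbd : ∀ n : ℕ, ∫⁻ x, ENNReal.ofReal (-Real.log (max (min (a x) 1) (Real.exp (-n)))) ∂μ
        ≤ ENNReal.ofReal (P - c) := by
      intro n
      have hle : Real.exp (-(n : ℝ)) ≤ 1 := Real.exp_le_one_iff.2 (by simp)
      rw [← hof _ (Real.exp_pos _) hle]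
      have h1 := hcon _ (Real.exp_pos (-(n : ℝ)))
      rw [hsplit _ (Real.exp_pos _) hle] at h1
      exact ENNReal.ofReal_le_ofReal (by linarith)
    have hPc : 0 ≤ P - c := by
      have := hcon 1 one_pos
      linarith
    have hlim : Tendsto (fun n : ℕ =>
        ∫⁻ x, ENNReal.ofReal (-Real.log (max (min (a x) 1) (Real.exp (-n)))) ∂μ) atTop (𝓝 Q) := by
      refine lintegral_tendsto_of_tendsto_of_monotone
        (fun n => (hi _ (Real.exp_pos _)).neg.aestronglyMeasurable.aemeasurable.ennreal_ofReal)
        (Eventually.of_forall fun x m n hmn => ?_)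
        (Eventually.of_forall fun x => tendsto_ofReal_neg_log_max (h0 x))
      refine ENNReal.ofReal_le_ofReal (neg_le_neg (Real.log_le_log (by positivity) ?_))
      exact max_le_max_left _ (Real.exp_le_exp.2 (neg_le_neg (by exact_mod_cast hmn)))
    have hQle : Q ≤ ENNReal.ofReal (P - c) := le_of_tendsto' hlim hbd
    have h2 : (Q : EReal) ≤ ((P - c : ℝ) : EReal) := by
      have := EReal.coe_ennreal_le_coe_ennreal_iff.2 hQle
      rwa [EReal.coe_ennreal_ofReal, max_eq_left hPc] at this
    refine absurd h (not_lt.2 ?_)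
    calc (c : EReal) = ((P - (P - c) : ℝ) : EReal) := by congr 1; ring
      _ = (P : EReal) - ((P - c : ℝ) : EReal) := EReal.coe_sub _ _
      _ ≤ (P : EReal) - Q := EReal.sub_le_sub le_rfl h2
  · rintro ⟨δ, hδ, h⟩
    -- Lowering the floor only lowers the integral, and a floor at most `1` allows the splitting
    -- `hsplit`.
    have hδ' : 0 < min δ 1 := lt_min hδ one_pos
    have h1 : ∫ x, Real.log (max (a x) (min δ 1)) ∂μ < c := by
      refine lt_of_le_of_lt (integral_mono (integrable_log_max ha hR hδ')
        (integrable_log_max ha hR hδ) fun x => ?_) h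
      exact Real.log_le_log (lt_max_of_lt_right hδ') (max_le_max_left _ (min_le_left _ _))
    rw [hsplit _ hδ' (min_le_right _ _)] at h1
    set q := ∫ x, -Real.log (max (min (a x) 1) (min δ 1)) ∂μ with hq
    have hq0 : 0 ≤ q := integral_nonneg (hnn _ hδ' (min_le_right _ _))
    have h2 : ENNReal.ofReal q ≤ Q := by
      rw [hof _ hδ' (min_le_right _ _)]
      exact lintegral_mono fun x => ofReal_neg_log_max_le _ _
    have h3 : (q : EReal) ≤ Q := by
      have := EReal.coe_ennreal_le_coe_ennreal_iff.2 h2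
      rwa [EReal.coe_ennreal_ofReal, max_eq_left hq0] at this
    calc (P : EReal) - Q ≤ (P : EReal) - q := EReal.sub_le_sub le_rfl h3
      _ = ((P - q : ℝ) : EReal) := (EReal.coe_sub _ _).symm
      _ < c := by exact_mod_cast h1

theorem logNorm_eq_log_ofReal {d : ℕ} (L : Matrix (Fin d) (Fin d) ℂ) :
    logNorm L = ENNReal.log (ENNReal.ofReal ‖L‖) := by
  rw [logNorm, Matrix.cstar_norm_def, ofReal_norm]

/-- Only an inequality, since the norm is `0` when `d = 0`. -/
theorem norm_one_matrix_le (d : ℕ) : ‖(1 : Matrix (Fin d) (Fin d) ℂ)‖ ≤ 1 := by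
  rw [Matrix.cstar_norm_def, map_one]
  exact ContinuousLinearMap.norm_id_le

/-! ### Products along the shift and averaging over offsets. -/

section Product

variable {I : Type*} {d : ℕ} (A : I → Matrix (Fin d) (Fin d) ℂ)

theorem shift_iterate_apply (x : ℕ → I) (m n : ℕ) : shift^[m] x n = x (m + n) := by
  induction m generalizing x n with
  | zero => simp
  | succ m ih =>
    rw [Function.iterate_succ_apply, ih, shift]
    congr 1
    ring

theorem product_add (x : ℕ → I) (m n : ℕ) :
    product A x (m + n) = product A (shift^[m] x) n * product A x m := by
  induction n with
  | zero => simp [product]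
  | succ n ih =>
    rw [← add_assoc, product, ih, product, shift_iterate_apply, mul_assoc]

variable {A}

theorem norm_product_le_pow {R : ℝ} (hR : ∀ i, ‖A i‖ ≤ R) (x : ℕ → I) (n : ℕ) :
    ‖product A x n‖ ≤ R ^ n := by
  induction n with
  | zero => simpa [product] using norm_one_matrix_le d
  | succ n ih =>
    rw [product, pow_succ']
    exact (norm_mul_le _ _).trans
      (mul_le_mul (hR _) ih (norm_nonneg _) ((norm_nonneg _).trans (hR (x n))))

theorem norm_product_mul_le_prod {w : (ℕ → I) → ℝ} {N : ℕ}
    (hw : ∀ x, ‖product A x N‖ ≤ w x) (x : ℕ → I) (q : ℕ) :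
    ‖product A x (q * N)‖ ≤ ∏ i ∈ Finset.range q, w (shift^[i * N] x) := by
  induction q with
  | zero => simpa [product] using norm_one_matrix_le d
  | succ q ih =>
    rw [add_mul, one_mul, product_add, Finset.prod_range_succ, mul_comm (Finset.prod _ _)]
    exact (norm_mul_le _ _).trans
      (mul_le_mul (hw _) ih (norm_nonneg _) ((norm_nonneg _).trans (hw _)))

/-- Each `j < q * N` is `r + i * N` for exactly one `r < N` and `i < q`. Multiplying over all
offsets `r` gives a Birkhoff product for `shift` itself, which matters because `shift^[N]` need not
be ergodic. -/
theorem prod_range_prod_shift (w : (ℕ → I) → ℝ) (N q : ℕ) (x : ℕ → I) :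
    ∏ r ∈ Finset.range N, ∏ i ∈ Finset.range q, w (shift^[i * N] (shift^[r] x)) =
      ∏ j ∈ Finset.range (q * N), w (shift^[j] x) := by
  induction q with
  | zero => simp
  | succ q ih =>
    simp_rw [Finset.prod_range_succ, Finset.prod_mul_distrib]
    rw [ih, add_mul, one_mul, Finset.prod_range_add]
    simp_rw [← Function.iterate_add_apply]

/-- Averaging over the offset modulo `N`: the growth of the cocycle is controlled by a Birkhoff
product of any majorant `w` of the norm of its `N`-step products. -/
theorem norm_product_pow_le_prod {R : ℝ} (hR1 : 1 ≤ R) (hR : ∀ i, ‖A i‖ ≤ R)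
    {w : (ℕ → I) → ℝ} {N : ℕ} (hw : ∀ x, ‖product A x N‖ ≤ w x) (x : ℕ → I) (q : ℕ) :
    ‖product A x ((q + 1) * N)‖ ^ N ≤
      (R ^ N) ^ N * ∏ j ∈ Finset.range (q * N), w (shift^[j] x) := by
  have key : ∀ r ∈ Finset.range N, ‖product A x ((q + 1) * N)‖ ≤
      R ^ N * ∏ i ∈ Finset.range q, w (shift^[i * N] (shift^[r] x)) := by
    intro r hr
    have hrN : r ≤ N := (Finset.mem_range.1 hr).le
    -- Cut the time interval into `r` initial factors, `q` blocks of length `N`, and `N - r` final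
    -- factors; the two ends cost `R ^ N` in total.
    have hn : (q + 1) * N = r + (q * N + (N - r)) := by
      rw [add_mul, one_mul]; omega
    rw [hn, product_add, product_add]
    have hR0 : 0 ≤ R := zero_le_one.trans hR1
    have hp := norm_product_mul_le_prod hw (shift^[r] x) q
    calc _ ≤ R ^ (N - r) * (∏ i ∈ Finset.range q, w (shift^[i * N] (shift^[r] x))) * R ^ r := by
          refine (norm_mul_le _ _).trans (mul_le_mul ?_ (norm_product_le_pow hR _ _)
            (norm_nonneg _) (mul_nonneg (by positivity) ((norm_nonneg _).trans hp)))
          exact (norm_mul_le _ _).trans (mul_le_mul (norm_product_le_pow hR _ _) hp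
            (norm_nonneg _) (by positivity))
      _ = _ := by
          rw [mul_right_comm, ← pow_add, Nat.sub_add_cancel hrN]
  calc _ = ∏ r ∈ Finset.range N, ‖product A x ((q + 1) * N)‖ := by simp
    _ ≤ ∏ r ∈ Finset.range N,
          (R ^ N * ∏ i ∈ Finset.range q, w (shift^[i * N] (shift^[r] x))) :=
        Finset.prod_le_prod (fun _ _ => norm_nonneg _) key
    _ = _ := by
        rw [Finset.prod_mul_distrib, prod_range_prod_shift]
        simp

/-- Where the floor is active the left side is exactly the first term on the right. Elsewhere, take
logarithms in `norm_product_pow_le_prod` and divide by `N`: the ends cost `N * log R`, and the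
Birkhoff average is compared with `m ≤ N * c`. -/
theorem log_max_norm_product_le {R : ℝ} (hR1 : 1 ≤ R) (hR : ∀ i, ‖A i‖ ≤ R) {N : ℕ} (hN : 1 ≤ N)
    {δ : ℝ} (hδ : 0 < δ) {c m : ℝ} (hm : m ≤ N * c) (x : ℕ → I) (q : ℕ) :
    Real.log (max ‖product A x ((q + 1) * N)‖ (Real.exp (((q + 1) * N : ℕ) * c))) ≤
      ((q + 1) * N : ℕ) * c + (N * Real.log R + N * |c|) +
        q * |birkhoffAverage ℝ shift (fun y => Real.log (max ‖product A y N‖ δ)) (q * N) x - m| := by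
  set a := birkhoffAverage ℝ shift (fun y => Real.log (max ‖product A y N‖ δ)) (q * N) x with ha
  have hN0 : (0 : ℝ) < N := by exact_mod_cast hN
  have h1 : 0 ≤ N * Real.log R := mul_nonneg hN0.le (Real.log_nonneg hR1)
  have h2 : 0 ≤ N * |c| := by positivity
  have h3 : 0 ≤ q * |a - m| := by positivity
  rcases le_total ‖product A x ((q + 1) * N)‖ (Real.exp (((q + 1) * N : ℕ) * c)) with h | h
  · rw [max_eq_right h, Real.log_exp]
    linarith
  · rw [max_eq_left h]
    have hpos := (Real.exp_pos _).trans_le h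
    have hw : ∀ y : ℕ → I, 0 < max ‖product A y N‖ δ := fun y => lt_max_of_lt_right hδ
    have h4 := Real.log_le_log (by positivity)
      (norm_product_pow_le_prod hR1 hR (w := fun y => max ‖product A y N‖ δ)
        (fun y => le_max_left _ _) x q)
    have hRpos : 0 < R := one_pos.trans_le hR1
    rw [Real.log_mul (by positivity) (Finset.prod_ne_zero_iff.2 fun j _ => (hw _).ne'),
      Real.log_pow, Real.log_pow, Real.log_pow, Real.log_prod fun j _ => (hw _).ne'] at h4
    have h5 : ∑ j ∈ Finset.range (q * N), Real.log (max ‖product A (shift^[j] x) N‖ δ) =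
        N * (q * a) := by
      rcases Nat.eq_zero_or_pos q with rfl | hq
      · simp
      · have hq0 : (0 : ℝ) < q := by exact_mod_cast hq
        rw [ha, birkhoffAverage, birkhoffSum, smul_eq_mul]
        push_cast
        field_simp
    rw [h5, ← mul_add] at h4
    have h6 := le_of_mul_le_mul_left h4 hN0
    have h7 : (q : ℝ) * a ≤ q * |a - m| + q * m := by
      rw [← mul_add]
      exact mul_le_mul_of_nonneg_left (by linarith [le_abs_self (a - m)]) (by positivity)
    have h8 : (q : ℝ) * m ≤ q * (N * c) := mul_le_mul_of_nonneg_left hm (by positivity)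
    -- The `q` blocks give `q * N * c` instead of `(q + 1) * N * c`; the term `N * |c|` covers the
    -- difference whatever the sign of `c`.
    have h9 : N * -|c| ≤ N * c := mul_le_mul_of_nonneg_left (neg_abs_le c) hN0.le
    push_cast
    nlinarith

variable [TopologicalSpace I]

theorem continuous_product (hA : Continuous A) (n : ℕ) :
    Continuous fun x : ℕ → I => product A x n := by
  induction n with
  | zero => exact continuous_const
  | succ n ih => exact (hA.comp (continuous_apply n)).mul ih

theorem exists_norm_le [CompactSpace I] (hA : Continuous A) : ∃ R : ℝ, 1 ≤ R ∧ ∀ i, ‖A i‖ ≤ R := by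
  obtain ⟨R, hR⟩ := isCompact_univ.exists_bound_of_continuousOn hA.continuousOn
  exact ⟨max 1 R, le_max_left _ _, fun i => (hR i trivial).trans (le_max_right _ _)⟩

end Product

/-! ### Exponents expressed through truncated integrals. -/

section Exponent

variable {I : Type*} [MetricSpace I] [CompactSpace I] [MeasurableSpace I] [BorelSpace I] {d : ℕ}
  {A : I → Matrix (Fin d) (Fin d) ℂ}

theorem measurable_norm_product (hA : Continuous A) (n : ℕ) :
    Measurable fun x : ℕ → I => ‖product A x n‖ := by
  have : SecondCountableTopology I := UniformSpace.secondCountable_of_separable I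
  exact (continuous_product hA n).norm.measurable

theorem integrable_log_max_norm_product (hA : Continuous A) (n : ℕ) (μ : Measure (ℕ → I))
    [IsFiniteMeasure μ] {δ : ℝ} (hδ : 0 < δ) :
    Integrable (fun x => Real.log (max ‖product A x n‖ δ)) μ := by
  obtain ⟨R, -, hR⟩ := exists_norm_le hA
  exact integrable_log_max (measurable_norm_product hA n) (fun x => norm_product_le_pow hR x n) hδ

/-- Reduces statements about exponents to finite real integrals at a single time; real strict upper
bounds determine an element of `EReal`. -/
theorem lyapunovExponent_lt_iff (hA : Continuous A) (μ : Measure (ℕ → I)) [IsProbabilityMeasure μ]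
    (c : ℝ) : lyapunovExponent A μ < c ↔
      ∃ n : ℕ, 1 ≤ n ∧ ∃ δ > 0, ∫ x, Real.log (max ‖product A x n‖ δ) ∂μ < n * c := by
  obtain ⟨R, -, hR⟩ := exists_norm_le hA
  simp only [lyapunovExponent, iInf_lt_iff, logNorm_eq_log_ofReal, exists_prop]
  refine exists_congr fun n => and_congr_right fun hn => ?_
  rw [EReal.div_lt_iff (by exact_mod_cast hn) (EReal.natCast_ne_top n), mul_comm]
  have : (n : EReal) * (c : EReal) = ((n * c : ℝ) : EReal) := by
    rw [EReal.coe_mul]; rfl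
  rw [this]
  exact extIntegral_log_lt_iff (measurable_norm_product hA n) (fun x => norm_nonneg _)
    (fun x => norm_product_le_pow hR x n) _

/-- If the exponent is below `c` then, along multiples of some `N`, the positive part of
`n⁻¹ log ‖A_{x_{n-1}} ⋯ A_{x_0}‖ - c` tends to zero in `L¹`. -/
theorem exists_eventually_integral_log_max_le (hA : Continuous A) {μ : Measure (ℕ → I)}
    [IsProbabilityMeasure μ] (hμ : Ergodic (shift (I := I)) μ) {c : ℝ}
    (hc : lyapunovExponent A μ < c) : ∃ N : ℕ, 1 ≤ N ∧ ∀ ε > 0, ∀ᶠ q : ℕ in atTop,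
      ∫ x, Real.log (max ‖product A x (q * N)‖ (Real.exp ((q * N : ℕ) * c))) ∂μ ≤
        (q * N : ℕ) * (c + ε) := by
  obtain ⟨R, hR1, hR⟩ := exists_norm_le hA
  obtain ⟨N, hN, δ, hδ, hlt⟩ := (lyapunovExponent_lt_iff hA μ c).1 hc
  refine ⟨N, hN, fun ε hε => ?_⟩
  set g : (ℕ → I) → ℝ := fun y => Real.log (max ‖product A y N‖ δ) with hg
  set m := ∫ y, g y ∂μ with hm
  set D := N * Real.log R + N * |c| with hD
  have hgm : Measurable g := ((measurable_norm_product hA N).max measurable_const).log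
  have hg2 : MemLp g 2 μ := by
    refine MemLp.of_bound hgm.aestronglyMeasurable (max |Real.log δ| |Real.log (max (R ^ N) δ)|)
      (Eventually.of_forall fun x => ?_)
    rw [Real.norm_eq_abs]
    exact abs_le_max_abs_abs (Real.log_le_log hδ (le_max_right _ _))
      (Real.log_le_log (by positivity) (max_le_max_right _ (norm_product_le_pow hR x N)))
  have herg := hμ.tendsto_integral_abs_birkhoffAverage_sub hg2
  have hmul : Tendsto (fun q : ℕ => q * N) atTop atTop :=
    tendsto_id.atTop_mul_const' (by omega)
  have he := (herg.comp hmul).eventually (gt_mem_nhds (half_pos hε))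
  have hD' : ∀ᶠ q : ℕ in atTop, D ≤ q * (ε / 2) :=
    (tendsto_natCast_atTop_atTop.atTop_mul_const (half_pos hε)).eventually_ge_atTop D
  -- Reindex by `q + 1`, as the pointwise bound concerns time `(q + 1) * N`. The constant `D` and
  -- the ergodic error each receive `q * (ε / 2)`.
  rw [← map_add_atTop_eq_nat 1, eventually_map]
  filter_upwards [he, hD'] with q h1 h2
  have hint : Integrable (fun x => |birkhoffAverage ℝ shift g (q * N) x - m|) μ := by
    have hk : ∀ k, Integrable (fun x => g (shift^[k] x)) μ := fun k =>
      (hμ.toMeasurePreserving.iterate k).integrable_comp_of_integrable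
        (hg2.integrable (by norm_num))
    exact (((integrable_finsetSum _ fun k _ => hk k).smul ((q * N : ℕ) : ℝ)⁻¹).sub (integrable_const m)).abs
  calc ∫ x, Real.log (max ‖product A x ((q + 1) * N)‖ (Real.exp (((q + 1) * N : ℕ) * c))) ∂μ
      ≤ ∫ x, ((((q + 1) * N : ℕ) * c + D) +
          q * |birkhoffAverage ℝ shift g (q * N) x - m|) ∂μ := by
        refine integral_mono (integrable_log_max_norm_product hA _ μ (Real.exp_pos _))
          ((integrable_const _).add (hint.const_mul _)) fun x => ?_
        exact log_max_norm_product_le hR1 hR hN hδ hlt.le x q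
    _ = (((q + 1) * N : ℕ) * c + D) +
          q * ∫ x, |birkhoffAverage ℝ shift g (q * N) x - m| ∂μ := by
        rw [integral_add (integrable_const _) (hint.const_mul _), integral_const_mul]
        simp
    _ ≤ (((q + 1) * N : ℕ) * c + D) + q * (ε / 2) := by
        gcongr
        exact h1.le
    _ ≤ ((q + 1) * N : ℕ) * (c + ε) := by
        have hN1 : (1 : ℝ) ≤ N := by exact_mod_cast hN
        have h3 : (q : ℝ) * ε ≤ ((q + 1) * N) * ε := by
          refine mul_le_mul_of_nonneg_right ?_ hε.le
          nlinarith [(Nat.cast_nonneg q : (0 : ℝ) ≤ q)]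
        push_cast
        nlinarith

/-- Monotonicity of the Lyapunov exponent with respect to domination up to a constant. -/
theorem lyapunovExponent_lt_of_norm_le {e : ℕ} {A' : I → Matrix (Fin e) (Fin e) ℂ}
    (hA : Continuous A) (hA' : Continuous A') {μ : Measure (ℕ → I)}
    [IsProbabilityMeasure μ] (hμ : Ergodic (shift (I := I)) μ) {C : ℝ} (hC1 : 1 ≤ C)
    (hC : ∀ x n, ‖product A' x n‖ ≤ C * ‖product A x n‖) {c : ℝ}
    (hc : lyapunovExponent A μ < c) : lyapunovExponent A' μ < c := by
  -- Half of the gap `c - c'` serves as the error `ε`, the other half absorbs `log C` at large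
  -- times.
  obtain ⟨c', h1, h2⟩ := EReal.lt_iff_exists_real_btwn.1 hc
  have h2' : c' < c := by exact_mod_cast h2
  obtain ⟨N, hN, h⟩ := exists_eventually_integral_log_max_le hA hμ h1
  have hε : 0 < (c - c') / 2 := by linarith
  have hlarge : ∀ᶠ q : ℕ in atTop, Real.log C < q * ((c - c') / 2) :=
    (tendsto_natCast_atTop_atTop.atTop_mul_const hε).eventually_gt_atTop _
  obtain ⟨q, hq1, hq2, hq3⟩ := ((h _ hε).and (hlarge.and (eventually_ge_atTop 1))).exists
  refine (lyapunovExponent_lt_iff hA' μ c).2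
    ⟨q * N, Nat.one_le_iff_ne_zero.2 (by positivity), _, Real.exp_pos ((q * N : ℕ) * c'), ?_⟩
  have hC0 : 0 < C := one_pos.trans_le hC1
  calc _ ≤ ∫ x, (Real.log C +
        Real.log (max ‖product A x (q * N)‖ (Real.exp ((q * N : ℕ) * c')))) ∂μ := by
        refine integral_mono (integrable_log_max_norm_product hA' _ μ (Real.exp_pos _))
          ((integrable_const _).add (integrable_log_max_norm_product hA _ μ (Real.exp_pos _)))
          fun x => ?_
        have hE := Real.exp_pos ((q * N : ℕ) * c')
        beta_reduce
        rw [← Real.log_mul hC0.ne' (lt_max_of_lt_right hE).ne', mul_max_of_nonneg _ _ hC0.le]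
        exact Real.log_le_log (lt_max_of_lt_right hE)
          (max_le_max (hC x _) (le_mul_of_one_le_left hE.le hC1))
    _ = Real.log C +
        ∫ x, Real.log (max ‖product A x (q * N)‖ (Real.exp ((q * N : ℕ) * c'))) ∂μ := by
        rw [integral_add (integrable_const _)
          (integrable_log_max_norm_product hA _ μ (Real.exp_pos _))]
        simp
    _ ≤ Real.log C + (q * N : ℕ) * (c' + (c - c') / 2) := by gcongr
    _ < (q * N : ℕ) * c := by
        have hN1 : (1 : ℝ) ≤ N := by exact_mod_cast hN
        have h3 : (q : ℝ) * ((c - c') / 2) ≤ (q * N) * ((c - c') / 2) := by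
          refine mul_le_mul_of_nonneg_right ?_ hε.le
          nlinarith [(Nat.cast_nonneg q : (0 : ℝ) ≤ q)]
        push_cast
        nlinarith

end Exponent

/-! ### Algebra of block triangular matrices. -/

section Blocks

variable {k d : ℕ}

/-- The upper triangular matrix assembled from its blocks `X`, `Y`, `Z`. -/
def upperBlocks (h : k ≤ d) :
    (Matrix (Fin k) (Fin k) ℂ × Matrix (Fin k) (Fin (d - k)) ℂ ×
      Matrix (Fin (d - k)) (Fin (d - k)) ℂ) →ₗ[ℂ] Matrix (Fin d) (Fin d) ℂ where
  toFun v := Matrix.reindex (blockEquiv h) (blockEquiv h) (Matrix.fromBlocks v.1 v.2.1 0 v.2.2)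
  map_add' v w := by
    ext i j
    obtain ⟨i, rfl⟩ := (blockEquiv h).surjective i
    obtain ⟨j, rfl⟩ := (blockEquiv h).surjective j
    rcases i with i | i <;> rcases j with j | j <;> simp
  map_smul' c v := by
    ext i j
    obtain ⟨i, rfl⟩ := (blockEquiv h).surjective i
    obtain ⟨j, rfl⟩ := (blockEquiv h).surjective j
    rcases i with i | i <;> rcases j with j | j <;> simp

/-- The upper triangular blocks of a square matrix. -/
def blocksOf (h : k ≤ d) : Matrix (Fin d) (Fin d) ℂ →ₗ[ℂ]
    (Matrix (Fin k) (Fin k) ℂ × Matrix (Fin k) (Fin (d - k)) ℂ ×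
      Matrix (Fin (d - k)) (Fin (d - k)) ℂ) where
  toFun L := (L.submatrix (blockEquiv h ∘ Sum.inl) (blockEquiv h ∘ Sum.inl),
    L.submatrix (blockEquiv h ∘ Sum.inl) (blockEquiv h ∘ Sum.inr),
    L.submatrix (blockEquiv h ∘ Sum.inr) (blockEquiv h ∘ Sum.inr))
  map_add' _ _ := rfl
  map_smul' _ _ := rfl

theorem blocksOf_upperBlocks (h : k ≤ d) (v) : blocksOf h (upperBlocks h v) = v := by
  refine Prod.ext ?_ (Prod.ext ?_ ?_) <;> ext i j
  · change Matrix.fromBlocks v.1 v.2.1 0 v.2.2 ((blockEquiv h).symm (blockEquiv h (Sum.inl i)))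
      ((blockEquiv h).symm (blockEquiv h (Sum.inl j))) = _
    simp
  · change Matrix.fromBlocks v.1 v.2.1 0 v.2.2 ((blockEquiv h).symm (blockEquiv h (Sum.inl i)))
      ((blockEquiv h).symm (blockEquiv h (Sum.inr j))) = _
    simp
  · change Matrix.fromBlocks v.1 v.2.1 0 v.2.2 ((blockEquiv h).symm (blockEquiv h (Sum.inr i)))
      ((blockEquiv h).symm (blockEquiv h (Sum.inr j))) = _
    simp

theorem upperBlocks_mul (h : k ≤ d) (X X' : Matrix (Fin k) (Fin k) ℂ)
    (Y Y' : Matrix (Fin k) (Fin (d - k)) ℂ) (Z Z' : Matrix (Fin (d - k)) (Fin (d - k)) ℂ) :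
    upperBlocks h (X, Y, Z) * upperBlocks h (X', Y', Z') =
      upperBlocks h (X * X', X * Y' + Y * Z', Z * Z') := by
  simp [upperBlocks, Matrix.reindex_apply, Matrix.submatrix_mul_equiv, Matrix.fromBlocks_multiply]

theorem upperBlocks_one (h : k ≤ d) : upperBlocks h (1, 0, 1) = 1 := by
  simp [upperBlocks, Matrix.fromBlocks_one]

variable {I : Type*}

/-- The off-diagonal block of the `n`-step products of an upper triangular family. -/
def offDiagonal (A₁ : I → Matrix (Fin k) (Fin k) ℂ)
    (A₂ : I → Matrix (Fin (d - k)) (Fin (d - k)) ℂ) (B : I → Matrix (Fin k) (Fin (d - k)) ℂ)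
    (x : ℕ → I) : ℕ → Matrix (Fin k) (Fin (d - k)) ℂ
  | 0 => 0
  | n + 1 => A₁ (x n) * offDiagonal A₁ A₂ B x n + B (x n) * product A₂ x n

/-- The off-diagonal block of a product is linear in `B`, so it scales by `t` at every time while
the diagonal blocks stay fixed. -/
theorem product_upperBlocks (h : k ≤ d) (A₁ : I → Matrix (Fin k) (Fin k) ℂ)
    (A₂ : I → Matrix (Fin (d - k)) (Fin (d - k)) ℂ) (B : I → Matrix (Fin k) (Fin (d - k)) ℂ)
    (t : ℂ) (x : ℕ → I) (n : ℕ) :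
    product (fun i => upperBlocks h (A₁ i, t • B i, A₂ i)) x n =
      upperBlocks h (product A₁ x n, t • offDiagonal A₁ A₂ B x n, product A₂ x n) := by
  induction n with
  | zero => simp [product, offDiagonal, upperBlocks_one]
  | succ n ih =>
    rw [product, ih, upperBlocks_mul, product, product, offDiagonal, smul_add, Matrix.mul_smul,
      Matrix.smul_mul]

theorem product_conj {M : Matrix (Fin d) (Fin d) ℂ} (hM : IsUnit M)
    (A : I → Matrix (Fin d) (Fin d) ℂ) (x : ℕ → I) (n : ℕ) :
    product (fun i => M⁻¹ * A i * M) x n = M⁻¹ * product A x n * M := by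
  have hdet := (Matrix.isUnit_iff_isUnit_det M).1 hM
  induction n with
  | zero => simp [product, Matrix.nonsing_inv_mul M hdet]
  | succ n ih =>
    rw [product, ih, product]
    simp only [Matrix.mul_assoc]
    rw [Matrix.mul_nonsing_inv_cancel_left M _ hdet]

theorem continuous_upperBlocks_smul [TopologicalSpace I] (h : k ≤ d)
    {A₁ : I → Matrix (Fin k) (Fin k) ℂ} {A₂ : I → Matrix (Fin (d - k)) (Fin (d - k)) ℂ}
    {B : I → Matrix (Fin k) (Fin (d - k)) ℂ} (h₁ : Continuous A₁) (h₂ : Continuous A₂)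
    (hB : Continuous B) (t : ℂ) : Continuous fun i => upperBlocks h (A₁ i, t • B i, A₂ i) := by
  have hv : Continuous fun i => (A₁ i, t • B i, A₂ i) :=
    h₁.prodMk (Continuous.prodMk (hB.const_smul t) h₂)
  exact (upperBlocks h).continuous_of_finiteDimensional.comp hv

theorem continuous_offDiagonal [TopologicalSpace I] {A₁ : I → Matrix (Fin k) (Fin k) ℂ}
    {A₂ : I → Matrix (Fin (d - k)) (Fin (d - k)) ℂ} {B : I → Matrix (Fin k) (Fin (d - k)) ℂ}
    (h₁ : Continuous A₁) (h₂ : Continuous A₂) (hB : Continuous B) (n : ℕ) :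
    Continuous fun x : ℕ → I => offDiagonal A₁ A₂ B x n := by
  induction n with
  | zero => exact continuous_const
  | succ n ih =>
    exact ((h₁.comp (continuous_apply n)).matrix_mul ih).add
      ((hB.comp (continuous_apply n)).matrix_mul (continuous_product h₂ n))

end Blocks

theorem _root_.LinearMap.exists_one_le_norm_le {E F : Type*} [NormedAddCommGroup E]
    [NormedSpace ℂ E] [FiniteDimensional ℂ E] [NormedAddCommGroup F] [NormedSpace ℂ F]
    (f : E →ₗ[ℂ] F) : ∃ C : ℝ, 1 ≤ C ∧ ∀ v, ‖f v‖ ≤ C * ‖v‖ :=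
  ⟨max 1 ‖f.toContinuousLinearMap‖, le_max_left _ _, fun v =>
    (f.toContinuousLinearMap.le_opNorm v).trans
      (mul_le_mul_of_nonneg_right (le_max_right _ _) (norm_nonneg v))⟩

/-! ### Comparison of exponents and the scaled triangular family. -/

section Exponent

variable {I : Type*} [MetricSpace I] [CompactSpace I] [MeasurableSpace I] [BorelSpace I] {k d : ℕ}

/-- Monotonicity of the Lyapunov exponent under linear images of the products. -/
theorem lyapunovExponent_lt_of_linearMap {d e : ℕ} {A : I → Matrix (Fin d) (Fin d) ℂ}
    {A' : I → Matrix (Fin e) (Fin e) ℂ} (hA : Continuous A) (hA' : Continuous A')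
    {μ : Measure (ℕ → I)} [IsProbabilityMeasure μ] (hμ : Ergodic (shift (I := I)) μ)
    (f : Matrix (Fin d) (Fin d) ℂ →ₗ[ℂ] Matrix (Fin e) (Fin e) ℂ)
    (hf : ∀ x n, product A' x n = f (product A x n)) {c : ℝ}
    (hc : lyapunovExponent A μ < c) : lyapunovExponent A' μ < c := by
  obtain ⟨C, hC1, hC⟩ := f.exists_one_le_norm_le
  exact lyapunovExponent_lt_of_norm_le hA hA' hμ hC1 (fun x n => hf x n ▸ hC _) hc

/-- Since `a, b ≥ E`, one has `max a b ≤ a * b / E`. This replaces the logarithm of a maximum, whose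
integral is hard to control, by a sum of logarithms at the price of `log E`. -/
theorem log_max_upperBlocks_le {C E : ℝ} (hC : 1 ≤ C) (hE : 0 < E) {h : k ≤ d}
    (hbound : ∀ v, ‖upperBlocks h v‖ ≤ C * ‖v‖) {X : Matrix (Fin k) (Fin k) ℂ}
    {Y : Matrix (Fin k) (Fin (d - k)) ℂ} {Z : Matrix (Fin (d - k)) (Fin (d - k)) ℂ}
    (hY : ‖Y‖ ≤ E) : Real.log (max ‖upperBlocks h (X, Y, Z)‖ E) ≤
      Real.log C - Real.log E + Real.log (max ‖X‖ E) + Real.log (max ‖Z‖ E) := by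
  have hC0 : 0 < C := one_pos.trans_le hC
  set a := max ‖X‖ E with ha
  set b := max ‖Z‖ E with hb
  have haE : E ≤ a := le_max_right _ _
  have hbE : E ≤ b := le_max_right _ _
  have ha0 : 0 < a := hE.trans_le haE
  have hb0 : 0 < b := hE.trans_le hbE
  have hmax : max a b ≤ a * b / E := by
    rw [le_div_iff₀ hE]
    rcases max_cases a b with ⟨h, -⟩ | ⟨h, -⟩ <;> rw [h] <;> nlinarith
  have hv : ‖(X, Y, Z)‖ ≤ max a b := by
    rw [Prod.norm_mk, Prod.norm_mk]
    exact max_le ((le_max_left _ _).trans (le_max_left _ _))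
      (max_le (hY.trans (haE.trans (le_max_left _ _)))
        ((le_max_left _ _).trans (le_max_right _ _)))
  have hle : max ‖upperBlocks h (X, Y, Z)‖ E ≤ C * (a * b / E) := by
    refine max_le ((hbound _).trans (mul_le_mul_of_nonneg_left (hv.trans hmax) hC0.le)) ?_
    exact (haE.trans ((le_max_left _ _).trans hmax)).trans
      (le_mul_of_one_le_left (by positivity) hC)
  refine (Real.log_le_log (lt_max_of_lt_right hE) hle).trans_eq ?_
  rw [Real.log_mul hC0.ne' (by positivity), Real.log_div (by positivity) hE.ne',
    Real.log_mul ha0.ne' hb0.ne']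
  ring

/-- If both diagonal blocks have exponent below `c`, so does the family obtained by scaling the
off-diagonal blocks by a suitably small nonzero factor. -/
theorem exists_lyapunovExponent_upperBlocks_lt (h : k ≤ d) {A₁ : I → Matrix (Fin k) (Fin k) ℂ}
    {A₂ : I → Matrix (Fin (d - k)) (Fin (d - k)) ℂ} {B : I → Matrix (Fin k) (Fin (d - k)) ℂ}
    (h₁ : Continuous A₁) (h₂ : Continuous A₂) (hB : Continuous B) {μ : Measure (ℕ → I)}
    [IsProbabilityMeasure μ] (hμ : Ergodic (shift (I := I)) μ) {c : ℝ}
    (hc₁ : lyapunovExponent A₁ μ < c) (hc₂ : lyapunovExponent A₂ μ < c) :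
    ∃ t : ℂ, t ≠ 0 ∧ lyapunovExponent (fun i => upperBlocks h (A₁ i, t • B i, A₂ i)) μ < c := by
  obtain ⟨c', hc', h3⟩ := EReal.lt_iff_exists_real_btwn.1 (max_lt hc₁ hc₂)
  have h3' : c' < c := by exact_mod_cast h3
  obtain ⟨N₁, hN₁, H₁⟩ :=
    exists_eventually_integral_log_max_le h₁ hμ ((le_max_left _ _).trans_lt hc')
  obtain ⟨N₂, hN₂, H₂⟩ :=
    exists_eventually_integral_log_max_le h₂ hμ ((le_max_right _ _).trans_lt hc')
  obtain ⟨C, hC1, hC⟩ := (upperBlocks h).exists_one_le_norm_le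
  -- Two shares go to the diagonal blocks and one to `log C`.
  set ε := (c - c') / 3 with hε
  have hε0 : 0 < ε := by rw [hε]; linarith
  have hlarge : ∀ᶠ q : ℕ in atTop, Real.log C < q * ε :=
    (tendsto_natCast_atTop_atTop.atTop_mul_const hε0).eventually_gt_atTop _
  -- The good times are multiples of `N₁` and of `N₂` respectively; `n = q * N₁ * N₂` serves both.
  have ht₁ : Tendsto (fun q : ℕ => q * N₂) atTop atTop := tendsto_id.atTop_mul_const' (by omega)
  have ht₂ : Tendsto (fun q : ℕ => q * N₁) atTop atTop := tendsto_id.atTop_mul_const' (by omega)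
  obtain ⟨q, hq1, hq2, hq3, hq4⟩ := ((ht₁.eventually (H₁ ε hε0)).and
    ((ht₂.eventually (H₂ ε hε0)).and (hlarge.and (eventually_ge_atTop 1)))).exists
  rw [show q * N₂ * N₁ = q * N₁ * N₂ by ring] at hq1
  set n := q * N₁ * N₂ with hn
  have hqn : (q : ℝ) ≤ n := by
    exact_mod_cast (Nat.le_mul_of_pos_right q hN₁).trans (Nat.le_mul_of_pos_right _ hN₂)
  have hE := Real.exp_pos ((n : ℝ) * c')
  set E := Real.exp ((n : ℝ) * c') with hEdef
  -- As `t` is chosen after `n`, a bound at this single time suffices and the growth of the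
  -- off-diagonal block is irrelevant. The `max` with `1` makes the divisor positive.
  obtain ⟨K, hK⟩ := isCompact_univ.exists_bound_of_continuousOn
    (continuous_offDiagonal h₁ h₂ hB n).continuousOn
  have hK1 : 0 < max K 1 := lt_max_of_lt_right one_pos
  set t : ℝ := E / max K 1 with ht
  have ht0 : 0 < t := div_pos hE hK1
  have hA : Continuous fun i => upperBlocks h (A₁ i, (t : ℂ) • B i, A₂ i) :=
    continuous_upperBlocks_smul h h₁ h₂ hB t
  refine ⟨t, by exact_mod_cast ht0.ne', (lyapunovExponent_lt_iff hA μ c).2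
    ⟨n, Nat.one_le_iff_ne_zero.2 (by positivity), E, hE, ?_⟩⟩
  have hi₁ := integrable_log_max_norm_product h₁ n μ hE
  have hi₂ := integrable_log_max_norm_product h₂ n μ hE
  have hi₀ : Integrable
      (fun x => Real.log C - Real.log E + Real.log (max ‖product A₁ x n‖ E)) μ :=
    (integrable_const _).add hi₁
  calc _ ≤ ∫ x, (Real.log C - Real.log E + Real.log (max ‖product A₁ x n‖ E) +
        Real.log (max ‖product A₂ x n‖ E)) ∂μ := by
        refine integral_mono (integrable_log_max_norm_product hA n μ hE)
          (hi₀.add hi₂) fun x => ?_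
        beta_reduce
        rw [product_upperBlocks]
        refine log_max_upperBlocks_le hC1 hE hC ?_
        rw [norm_smul, Complex.norm_real, Real.norm_of_nonneg ht0.le]
        calc t * ‖offDiagonal A₁ A₂ B x n‖ ≤ t * max K 1 :=
              mul_le_mul_of_nonneg_left ((hK x trivial).trans (le_max_left _ _)) ht0.le
          _ = E := div_mul_cancel₀ _ hK1.ne'
    _ = Real.log C - n * c' + ∫ x, Real.log (max ‖product A₁ x n‖ E) ∂μ +
        ∫ x, Real.log (max ‖product A₂ x n‖ E) ∂μ := by
        rw [integral_add hi₀ hi₂,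
          integral_add (integrable_const _) hi₁, hEdef, Real.log_exp]
        simp
    _ ≤ Real.log C - n * c' + n * (c' + ε) + n * (c' + ε) := by gcongr
    _ < n * c := by
        have h4 : (q : ℝ) * ε ≤ n * ε := mul_le_mul_of_nonneg_right hqn hε0.le
        have h5 : (n : ℝ) * c = n * c' + 3 * (n * ε) := by rw [hε]; ring
        linarith

end Exponent

/-- The Lyapunov exponent of an upper triangular family is the larger of those of its diagonal
blocks. -/
theorem lyapunovExponent_eq_max {I : Type*} [MetricSpace I] [CompactSpace I]
    [MeasurableSpace I] [BorelSpace I] {d k : ℕ} {A : I → Matrix (Fin d) (Fin d) ℂ}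
    (hA : Continuous A) {A₁ : I → Matrix (Fin k) (Fin k) ℂ}
    {A₂ : I → Matrix (Fin (d - k)) (Fin (d - k)) ℂ} {B : I → Matrix (Fin k) (Fin (d - k)) ℂ}
    {M : Matrix (Fin d) (Fin d) ℂ} (hT : IsUpperTriangularisation A A₁ A₂ B M)
    {μ : Measure (ℕ → I)} [IsProbabilityMeasure μ] (hμ : Ergodic (shift (I := I)) μ) :
    lyapunovExponent A μ = max (lyapunovExponent A₁ μ) (lyapunovExponent A₂ μ) := by
  have hk := hT.lt.le
  have hdet := (Matrix.isUnit_iff_isUnit_det M).1 hT.isUnit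
  let f : Matrix (Fin d) (Fin d) ℂ →ₗ[ℂ] Matrix (Fin d) (Fin d) ℂ :=
    (LinearMap.mulRight ℂ M).comp (LinearMap.mulLeft ℂ M⁻¹)
  let g : Matrix (Fin d) (Fin d) ℂ →ₗ[ℂ] Matrix (Fin d) (Fin d) ℂ :=
    (LinearMap.mulRight ℂ M⁻¹).comp (LinearMap.mulLeft ℂ M)
  have hgf : ∀ L, g (f L) = L := fun L => by
    simp [f, g, Matrix.mul_assoc, Matrix.mul_nonsing_inv_cancel_left M _ hdet,
      Matrix.mul_nonsing_inv M hdet]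
  have hconj : ∀ i, upperBlocks hk (A₁ i, B i, A₂ i) = f (A i) := fun i => (hT.conj i).symm
  have hprod : ∀ x n, f (product A x n) =
      upperBlocks hk (product A₁ x n, offDiagonal A₁ A₂ B x n, product A₂ x n) := by
    intro x n
    have h1 := product_upperBlocks hk A₁ A₂ B 1 x n
    simp only [one_smul] at h1
    rw [← h1]
    simp_rw [hconj]
    exact (product_conj hT.isUnit A x n).symm
  -- Continuity of the blocks is inherited from `A`, of which they are linear functions.
  have hblocks : Continuous fun i => (A₁ i, B i, A₂ i) := by
    have h1 : (fun i => (A₁ i, B i, A₂ i)) = fun i => blocksOf hk (f (A i)) := by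
      funext i
      rw [← hconj, blocksOf_upperBlocks]
    rw [h1]
    exact ((blocksOf hk).comp f).continuous_of_finiteDimensional.comp hA
  have h₁ : Continuous A₁ := hblocks.fst
  have hB : Continuous B := hblocks.snd.fst
  have h₂ : Continuous A₂ := hblocks.snd.snd
  have key : ∀ c : ℝ, lyapunovExponent A μ < c ↔
      max (lyapunovExponent A₁ μ) (lyapunovExponent A₂ μ) < c := by
    intro c
    constructor
    · intro hc
      refine max_lt ?_ ?_
      · refine lyapunovExponent_lt_of_linearMap hA h₁ hμ
          ((LinearMap.fst ℂ _ _).comp ((blocksOf hk).comp f)) (fun x n => ?_) hc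
        simp [hprod, blocksOf_upperBlocks]
      · refine lyapunovExponent_lt_of_linearMap hA h₂ hμ
          ((LinearMap.snd ℂ _ _).comp ((LinearMap.snd ℂ _ _).comp ((blocksOf hk).comp f)))
          (fun x n => ?_) hc
        simp [hprod, blocksOf_upperBlocks]
    · intro hc
      obtain ⟨t, ht, hlt⟩ := exists_lyapunovExponent_upperBlocks_lt hk h₁ h₂ hB hμ
        ((le_max_left _ _).trans_lt hc) ((le_max_right _ _).trans_lt hc)
      -- The linear map reads off the blocks, divides the off-diagonal one by `t`, reassembles them,
      -- and undoes the conjugation by `M`.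
      refine lyapunovExponent_lt_of_linearMap (continuous_upperBlocks_smul hk h₁ h₂ hB t) hA hμ
        (g.comp ((upperBlocks hk).comp ((LinearMap.prodMap LinearMap.id
          (LinearMap.prodMap (t⁻¹ • LinearMap.id) LinearMap.id)).comp (blocksOf hk))))
        (fun x n => ?_) hlt
      rw [product_upperBlocks]
      simp [blocksOf_upperBlocks, smul_smul, ht, ← hprod, hgf]
  refine le_antisymm (not_lt.1 fun hlt => ?_) (not_lt.1 fun hlt => ?_)
  · obtain ⟨c, hc1, hc2⟩ := EReal.lt_iff_exists_real_btwn.1 hlt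
    exact (hc2.trans ((key c).2 hc1)).false
  · obtain ⟨c, hc1, hc2⟩ := EReal.lt_iff_exists_real_btwn.1 hlt
    exact (hc2.trans ((key c).1 hc1)).false

end MatrixCocycle

theorem mainTheorem11 {I : Type*} [MetricSpace I] [CompactSpace I]
    [MeasurableSpace I] [BorelSpace I] {d k : ℕ}
    (A : I → Matrix (Fin d) (Fin d) ℂ) (hA : Continuous A)
    (A₁ : I → Matrix (Fin k) (Fin k) ℂ) (A₂ : I → Matrix (Fin (d - k)) (Fin (d - k)) ℂ)
    (B : I → Matrix (Fin k) (Fin (d - k)) ℂ) (M : Matrix (Fin d) (Fin d) ℂ)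
    (hT : MatrixCocycle.IsUpperTriangularisation A A₁ A₂ B M)
    (μ : MeasureTheory.Measure (ℕ → I)) [MeasureTheory.IsProbabilityMeasure μ]
    (hμ : Ergodic (MatrixCocycle.shift (I := I)) μ) :
    MatrixCocycle.lyapunovExponent A μ =
      max (MatrixCocycle.lyapunovExponent A₁ μ) (MatrixCocycle.lyapunovExponent A₂ μ) := by
  exact MatrixCocycle.lyapunovExponent_eq_max hA hT hμ
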